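/- Let $\mathcal{B}$ be a locally finitely presentable category and let $\mathcal{V}$ be a saturated class in $\mathcal{B}$: a class of morphisms between finitely presentable objects of $\mathcal{B}$ which is closed under composition, contains all isomorphisms between finitely presentable objects, is right-cancellative (if $k \in \mathcal{V}$ and $fk \in \mathcal{V}$ then $f \in \mathcal{V}$), is closed under pushouts along arbitrary morphisms between finitely presentable objects, and is closed under finite colimits in the arrow category of $\mathcal{B}$. For an object $B$ of $\mathcal{B}$, the etale generator $\mathcal{V}_B$ is the full subcategory of the coslice $B \downarrow \mathcal{B}$ on the morphisms $n : B \to D$ that are a pushout of some $k : K \to K'$ in $\mathcal{V}$ along some $a : K \to B$. For $m : B_1 \to B_2$ in $\mathcal{B}$, pushout along $m$ defines a functor $m_* : \mathcal{V}_{B_1} \to \mathcal{V}_{B_2}$, and these functors are pseudofunctorial in $m$. Let $l : B \to C$ be an arrow in $\mathrm{Ind}(\mathcal{V}_B)$, that is, a morphism of $\mathcal{B}$ which is a small filtered colimit in $B \downarrow \mathcal{B}$ of objects of $\mathcal{V}_B$. Let $h_l : \mathcal{V}_B^{\mathrm{op}} \to \mathrm{Set}$, $n \mapsto (B \downarrow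 \mathcal{B})[n, l]$, be the functor represented by $l$, and let $\int h_l$ be its category of elements; its objects are the pairs $(n,a)$ with $n \in \mathcal{V}_B$ and $a : \mathrm{cod}(n) \to C$ such that $an = l$, and a morphism $(n_1,a_1) \to (n_2,a_2)$ of the opposite category $(\int h_l)^{\mathrm{op}}$ is an $m : \mathrm{cod}(n_1) \to \mathrm{cod}(n_2)$ with $m n_1 = n_2$ and $a_2 m = a_1$. Then $\int h_l$ is cofiltered, and $\mathcal{V}_C$, with the pseudococone $(a_* : \mathcal{V}_{\mathrm{cod}(n)} \to \mathcal{V}_C)_{(n,a)}$ of pushout functors and the canonical isomorphisms $(a_2)_* m_* \cong (a_1)_*$, is a pseudocolimit \[ \mathcal{V}_C \simeq \operatorname*{colim}_{(n,a) \in (\int h_l)^{\mathrm{op}}} \mathcal{V}_{\mathrm{cod}(n)} \] in $\mathbf{Cat}$ of the pseudofunctor $(\int h_l)^{\mathrm{op}} \to \mathbf{Cat}$, $(n,a) \mapsto \mathcal{V}_{\mathrm{cod}(n)}$, $m \mapsto m_*$: for every category $\mathcal{E}$, composition with $(a_*)_{(n,a)}$ is an equivalence from the category of functors $\mathcal{V}_C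 \to \mathcal{E}$ to the category of pseudococones with vertex $\mathcal{E}$. Moreover, the comparison functor $\langle a_* \rangle$ to $\mathcal{V}_C$ from the explicit pseudocolimit, the localization of the Grothendieck construction of this pseudofunctor at its opcartesian morphisms, is essentially surjective, full and faithful. -/

import Mathlib

open CategoryTheory CategoryTheory.Limits Opposite

set_option linter.unusedSimpArgs false

universe w₁ w₂ v₁ u₁ v₂ u₂ v₃ u₃ v u

/-! ### Pseudocolimits of categories -/

/-- A pseudococone with vertex `D` on a pseudofunctor `F : J ⥤ Cat` (with `J` a category): a family
of functors `F j ⥤ D` with coherent natural isomorphisms `F f ⋙ leg j ≅ leg i` for `f : i ⟶ j`. -/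
structure Pseudococone {J : Type u₁} [Category.{v₁} J] (F : Pseudofunctor (LocallyDiscrete J) Cat.{v₂, u₂})
    (D : Type u₃) [Category.{v₃} D] where
  leg (j : J) : F.obj ⟨j⟩ ⥤ D
  iso {i j : J} (f : i ⟶ j) : (F.map f.toLoc).toFunctor ⋙ leg j ≅ leg i
  iso_id (j : J) (x : F.obj ⟨j⟩) :
    (iso (𝟙 j)).hom.app x = (leg j).map ((F.mapId ⟨j⟩).hom.toNatTrans.app x)
  iso_comp {i j k : J} (f : i ⟶ j) (g : j ⟶ k) (x : F.obj ⟨i⟩) :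
    (iso (f ≫ g)).hom.app x =
      (leg k).map ((F.mapComp f.toLoc g.toLoc).hom.toNatTrans.app x) ≫
        (iso g).hom.app ((F.map f.toLoc).toFunctor.obj x) ≫ (iso f).hom.app x

namespace Pseudococone

section

variable {J : Type u₁} [Category.{v₁} J] {F : Pseudofunctor (LocallyDiscrete J) Cat.{v₂, u₂}}
  {D : Type u₃} [Category.{v₃} D]

/-- A morphism of pseudococones with the same vertex (a modification). -/
@[ext]
structure Hom (c d : Pseudococone F D) where
  app (j : J) : c.leg j ⟶ d.leg j
  comm {i j : J} (f : i ⟶ j) (x : F.obj ⟨i⟩) :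
    (c.iso f).hom.app x ≫ (app i).app x =
      (app j).app ((F.map f.toLoc).toFunctor.obj x) ≫ (d.iso f).hom.app x

/-- The category of pseudococones on `F` with vertex `D`. -/
instance : Category (Pseudococone F D) where
  Hom c d := Hom c d
  id c :=
    { app := fun j => 𝟙 (c.leg j)
      comm := fun f x => by simp }
  comp α β :=
    { app := fun j => α.app j ≫ β.app j
      comm := fun f x => by
        rw [NatTrans.comp_app, NatTrans.comp_app, ← Category.assoc, α.comm, Category.assoc,
          β.comm, Category.assoc] }
  id_comp α := Hom.ext (funext fun j => Category.id_comp (α.app j))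
  comp_id α := Hom.ext (funext fun j => Category.comp_id (α.app j))
  assoc α β γ := Hom.ext (funext fun j => Category.assoc (α.app j) (β.app j) (γ.app j))

/-- Composition of a pseudococone with a functor out of its vertex. -/
def whisker (c : Pseudococone F D) {E : Type w₂} [Category.{w₁} E] (G : D ⥤ E) :
    Pseudococone F E where
  leg j := c.leg j ⋙ G
  iso f := Functor.isoWhiskerRight (c.iso f) G
  iso_id j x := congrArg G.map (c.iso_id j x)
  iso_comp f g x :=
    (congrArg G.map (c.iso_comp f g x)).trans
      ((G.map_comp _ _).trans (congrArg (G.map _ ≫ ·) (G.map_comp _ _)))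

/-- Composition with a pseudococone with vertex `D`, as a functor from the category of functors
`D ⥤ E` to the category of pseudococones with vertex `E`. -/
def precomp (c : Pseudococone F D) (E : Type w₂) [Category.{w₁} E] :
    (D ⥤ E) ⥤ Pseudococone F E where
  obj G := c.whisker G
  map α :=
    { app := fun j => Functor.whiskerLeft (c.leg j) α
      comm := fun f x => α.naturality ((c.iso f).hom.app x) }
  map_id _ := rfl
  map_comp _ _ := rfl

/-- A pseudococone with vertex `D` is a pseudocolimit if, for every category `E`, composition with
it is an equivalence from the functors `D ⥤ E` to the pseudococones with vertex `E`. -/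
def IsPseudocolimit (c : Pseudococone F D) : Prop :=
  ∀ (E : Type w₂) [Category.{w₁} E], (c.precomp E).IsEquivalence

end

end Pseudococone

/-- The opcartesian morphisms of the Grothendieck construction of `F`: those morphisms
`(f, φ : (F f) x ⟶ y)` for which `φ` is invertible. -/
def opcartesianMorphisms {J : Type u₁} [Category.{v₁} J] (F : Pseudofunctor (LocallyDiscrete J) Cat.{v₂, u₂}) :
    MorphismProperty (Pseudofunctor.Grothendieck F) :=
  fun _ _ f => IsIso f.fiber

/-- The pseudocolimit of `F` as an explicit category: the localization of the Grothendieck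
construction (the oplax colimit) of `F` at the opcartesian morphisms. -/
abbrev Pseudocolimit {J : Type u₁} [Category.{v₁} J] (F : Pseudofunctor (LocallyDiscrete J) Cat.{v₂, u₂}) :=
  (opcartesianMorphisms F).Localization

namespace Pseudococone

variable {J : Type u₁} [Category.{v₁} J] {F : Pseudofunctor (LocallyDiscrete J) Cat.{v₂, u₂}}
  {D : Type u₃} [Category.{v₃} D] (c : Pseudococone F D)

lemma comp_aux {A A' A₂ P Q Q₂ R : D} (I : A ≅ P) (M : A ⟶ A') (G : A' ≅ Q) (H : Q ≅ P)
    (h : I.hom = M ≫ G.hom ≫ H.hom) (φ : Q ⟶ Q₂) (G₂ : A₂ ≅ Q₂) (φ' : A' ⟶ A₂)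
    (nat : φ ≫ G₂.inv = G.inv ≫ φ') (ψ : A₂ ⟶ R) :
    I.inv ≫ M ≫ φ' ≫ ψ = (H.inv ≫ φ) ≫ G₂.inv ≫ ψ := by
  rw [Category.assoc, reassoc_of% nat, Iso.inv_comp_eq, h]
  simp

/-- The functor on the Grothendieck construction induced by a pseudococone. -/
def fromGrothendieck : Pseudofunctor.Grothendieck F ⥤ D where
  obj p := (c.leg p.base).obj p.fiber
  map {p q} f := (c.iso f.base).inv.app p.fiber ≫ (c.leg q.base).map f.fiber
  map_id p :=
    (congrArg ((c.iso (𝟙 p.base)).inv.app p.fiber ≫ ·) (c.iso_id p.base p.fiber).symm).trans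
      ((c.iso (𝟙 p.base)).inv_hom_id_app p.fiber)
  map_comp {p q r} f g :=
    (congrArg ((c.iso (f.base ≫ g.base)).inv.app p.fiber ≫ ·)
      (((c.leg r.base).map_comp _ _).trans (congrArg (_ ≫ ·) ((c.leg r.base).map_comp _ _)))).trans
      (Pseudococone.comp_aux ((c.iso (f.base ≫ g.base)).app p.fiber) _
        ((c.iso g.base).app ((F.map f.base.toLoc).toFunctor.obj p.fiber))
        ((c.iso f.base).app p.fiber) (c.iso_comp f.base g.base p.fiber) _
        ((c.iso g.base).app q.fiber) _ ((c.iso g.base).inv.naturality f.fiber) _)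

lemma fromGrothendieck_inverts :
    (opcartesianMorphisms F).IsInvertedBy c.fromGrothendieck := by
  intro p q f hf
  have : IsIso f.fiber := hf
  change IsIso ((c.iso f.base).inv.app p.fiber ≫ (c.leg q.base).map f.fiber)
  infer_instance

/-- The functor from the pseudocolimit induced by a pseudococone. -/
noncomputable def desc : Pseudocolimit F ⥤ D :=
  Localization.Construction.lift c.fromGrothendieck c.fromGrothendieck_inverts

end Pseudococone

/-! ### Saturated classes and etale generators -/

section

variable {B : Type u} [Category.{v} B]

/-- A saturated class: a class of morphisms between finitely presentable objects that is closed
under composition, contains all isomorphisms (between finitely presentable objects), is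
right-cancellative (if `l` and `l ≫ f` are in `V`, so is `f`), and is closed under pushouts along
arbitrary morphisms between finitely presentable objects and under finite colimits in the category
of arrows. -/
structure IsSaturatedClass (V : MorphismProperty B) : Prop where
  isFinitelyPresentable {K K' : B} (k : K ⟶ K') :
    V k → IsFinitelyPresentable.{v} K ∧ IsFinitelyPresentable.{v} K'
  comp {K₁ K₂ K₃ : B} (k : K₁ ⟶ K₂) (k' : K₂ ⟶ K₃) : V k → V k' → V (k ≫ k')
  of_isIso {K K' : B} (k : K ⟶ K') [IsIso k] :
    IsFinitelyPresentable.{v} K → IsFinitelyPresentable.{v} K' → V k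
  right_cancel {K₁ K₂ K₃ : B} (k : K₁ ⟶ K₂) (f : K₂ ⟶ K₃) : V k → V (k ≫ f) → V f
  of_isPushout {K K' L L' : B} {k : K ⟶ K'} {f : K ⟶ L} {f' : K' ⟶ L'} {k' : L ⟶ L'} :
    IsPushout k f f' k' → IsFinitelyPresentable.{v} L → V k → V k'
  finite_colimits (J : Type) [SmallCategory J] [FinCategory J] :
    V.IsStableUnderColimitsOfShape J

/-- The morphisms `n : X ⟶ D` that are pushouts of some `k : K ⟶ K'` in `V` along some
`a : K ⟶ X`, as objects of the category under `X`. -/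
def etaleMap (V : MorphismProperty B) (X : B) : ObjectProperty (Under X) :=
  fun n => ∃ (K K' : B) (k : K ⟶ K') (a : K ⟶ X) (b : K' ⟶ n.right),
    V k ∧ IsPushout k a b n.hom

/-- The etale generator at `X`, a full subcategory of the category under `X`. -/
abbrev EtaleGenerator (V : MorphismProperty B) (X : B) := (etaleMap V X).FullSubcategory

lemma comp_inv_aux {P Q R S T : B} (c : P ≅ Q) (M : Q ⟶ S) (d : P ≅ R) (e : R ≅ S)
    (h : c.hom ≫ M = d.hom ≫ e.hom) (t : R ⟶ T) :
    c.hom ≫ M ≫ e.inv ≫ t = d.hom ≫ t := by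
  rw [reassoc_of% h, Iso.hom_inv_id_assoc]

lemma inv_eq_aux {P Q R S : B} (c : P ≅ Q) (M : Q ⟶ S) (d : P ≅ R) (e : R ≅ S)
    (h : c.hom ≫ M = d.hom ≫ e.hom) : c.inv = M ≫ e.inv ≫ d.inv := by
  rw [← Category.comp_id c.inv, Iso.inv_comp_eq, comp_inv_aux c M d e h, Iso.hom_inv_id]

variable [HasPushouts B] (V : MorphismProperty B)

lemma etaleMap_pushout {X Y : B} (f : X ⟶ Y) (n : EtaleGenerator V X) :
    etaleMap V Y ((Under.pushout f).obj n.obj) := by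
  obtain ⟨K, K', k, a, b, hk, h⟩ := n.property
  exact ⟨K, K', k, a ≫ f, b ≫ pushout.inl _ _, hk,
    (h.flip.paste_horiz (IsPushout.of_hasPushout n.obj.hom f).flip).flip⟩

/-- The pushout functor `f_*` between etale generators. -/
noncomputable def pushoutFunctor {X Y : B} (f : X ⟶ Y) : EtaleGenerator V X ⥤ EtaleGenerator V Y :=
  (etaleMap V Y).lift ((etaleMap V X).ι ⋙ Under.pushout f) (etaleMap_pushout V f)

/-- For `f = 𝟙 X`, the pushout of `n : X ⟶ D` along `f` is `D`. -/
noncomputable def pushoutIdIso {X D : B} (n : X ⟶ D) (f : X ⟶ X) (hf : f = 𝟙 X) :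
    pushout n f ≅ D where
  hom := pushout.desc (𝟙 D) n (by simp [hf])
  inv := pushout.inl n f
  hom_inv_id := by
    apply pushout.hom_ext
    · rw [pushout.inl_desc_assoc, Category.id_comp, Category.comp_id]
    · rw [pushout.inr_desc_assoc, Category.comp_id, pushout.condition, hf, Category.id_comp]
  inv_hom_id := by rw [pushout.inl_desc]

/-- For `h = f ≫ g`, the pushout of `n : X ⟶ D` along `h` is the pushout along `g` of its pushout
along `f`. -/
noncomputable def pushoutCompIso {X Y Z D : B} (n : X ⟶ D) (f : X ⟶ Y) (g : Y ⟶ Z) (h : X ⟶ Z)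
    (hh : h = f ≫ g) : pushout n h ≅ pushout (pushout.inr n f) g where
  hom := pushout.desc (pushout.inl n f ≫ pushout.inl _ g) (pushout.inr _ g) (by
    rw [pushout.condition_assoc, pushout.condition, hh, Category.assoc])
  inv := pushout.desc (pushout.desc (pushout.inl n h) (g ≫ pushout.inr n h) (by
    rw [pushout.condition, hh, Category.assoc])) (pushout.inr n h) (by rw [pushout.inr_desc])
  hom_inv_id := by
    apply pushout.hom_ext <;> simp [pushout.inl_desc, pushout.inr_desc, pushout.inl_desc_assoc,
      pushout.inr_desc_assoc]
  inv_hom_id := by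
    apply pushout.hom_ext
    · apply pushout.hom_ext
      · simp [pushout.inl_desc, pushout.inl_desc_assoc]
      · simp [pushout.inr_desc, pushout.inl_desc_assoc, pushout.inr_desc_assoc,
          pushout.condition]
    · simp [pushout.inr_desc, pushout.inr_desc_assoc]

/-- The functoriality in `n : X ⟶ D` of the pushout along `f`. -/
noncomputable def pushoutMap {X Y D D' : B} {n : X ⟶ D} {n' : X ⟶ D'} (f : X ⟶ Y) (r : D ⟶ D')
    (hr : n ≫ r = n') : pushout n f ⟶ pushout n' f :=
  pushout.desc (r ≫ pushout.inl n' f) (pushout.inr n' f)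
    (by rw [← pushout.condition, ← hr, Category.assoc])

lemma pushoutIdIso_natural {X D D' : B} {n : X ⟶ D} {n' : X ⟶ D'} (f : X ⟶ X) (hf : f = 𝟙 X)
    (r : D ⟶ D') (hr : n ≫ r = n') :
    pushoutMap f r hr ≫ (pushoutIdIso n' f hf).hom = (pushoutIdIso n f hf).hom ≫ r := by
  apply pushout.hom_ext <;> simp [pushoutMap, pushoutIdIso, hr, pushout.inl_desc, pushout.inr_desc,
    pushout.inl_desc_assoc, pushout.inr_desc_assoc, Category.assoc, Category.comp_id,
    Category.id_comp]

lemma inr_pushoutMap {X Y D D' : B} {n : X ⟶ D} {n' : X ⟶ D'} (f : X ⟶ Y)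
    (r : D ⟶ D') (hr : n ≫ r = n') :
    pushout.inr n f ≫ pushoutMap f r hr = pushout.inr n' f :=
  pushout.inr_desc _ _ _

lemma inr_pushoutCompIso_hom {X Y Z D : B} (n : X ⟶ D) (f : X ⟶ Y) (g : Y ⟶ Z) (h : X ⟶ Z)
    (hh : h = f ≫ g) :
    pushout.inr n h ≫ (pushoutCompIso n f g h hh).hom = pushout.inr _ g :=
  pushout.inr_desc _ _ _

lemma inr_pushoutIdIso_hom {X D : B} (n : X ⟶ D) (f : X ⟶ X) (hf : f = 𝟙 X) :
    pushout.inr n f ≫ (pushoutIdIso n f hf).hom = n :=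
  pushout.inr_desc _ _ _

lemma pushoutCompIso_natural {X Y Z D D' : B} {n : X ⟶ D} {n' : X ⟶ D'} (f : X ⟶ Y) (g : Y ⟶ Z)
    (h : X ⟶ Z) (hh : h = f ≫ g) (r : D ⟶ D') (hr : n ≫ r = n') :
    pushoutMap h r hr ≫ (pushoutCompIso n' f g h hh).hom = (pushoutCompIso n f g h hh).hom ≫
      pushoutMap g (pushoutMap f r hr) (inr_pushoutMap f r hr) := by
  apply pushout.hom_ext <;> simp [pushoutMap, pushoutCompIso, pushout.inl_desc, pushout.inr_desc,
    pushout.inl_desc_assoc, pushout.inr_desc_assoc, Category.assoc, Category.comp_id,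
    Category.id_comp]

lemma pushoutCompIso_assoc {X Y Z W D : B} (n : X ⟶ D) (f : X ⟶ Y) (g : Y ⟶ Z) (h : Z ⟶ W)
    (fg : X ⟶ Z) (gh : Y ⟶ W) (k : X ⟶ W) (hfg : fg = f ≫ g) (hgh : gh = g ≫ h)
    (hk : k = fg ≫ h) (hk' : k = f ≫ gh) :
    (pushoutCompIso n fg h k hk).hom ≫
      pushoutMap h (pushoutCompIso n f g fg hfg).hom (inr_pushoutCompIso_hom n f g fg hfg) =
    (pushoutCompIso n f gh k hk').hom ≫ (pushoutCompIso (pushout.inr n f) g h gh hgh).hom := by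
  apply pushout.hom_ext <;> simp [pushoutMap, pushoutCompIso, pushout.inl_desc, pushout.inr_desc,
    pushout.inl_desc_assoc, pushout.inr_desc_assoc, Category.assoc, Category.comp_id,
    Category.id_comp]

lemma pushoutCompIso_id_left {X Y D : B} (n : X ⟶ D) (e : X ⟶ X) (he : e = 𝟙 X) (f k : X ⟶ Y)
    (hk : k = e ≫ f) (hk' : k = f) :
    (pushoutCompIso n e f k hk).hom ≫
      pushoutMap f (pushoutIdIso n e he).hom (inr_pushoutIdIso_hom n e he) =
    eqToHom (by rw [hk']) := by
  subst hk'
  apply pushout.hom_ext <;> simp [pushoutMap, pushoutCompIso, pushoutIdIso, pushout.inl_desc, pushout.inr_desc,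
    pushout.inl_desc_assoc, pushout.inr_desc_assoc, Category.assoc, Category.comp_id,
    Category.id_comp]

lemma pushoutCompIso_id_right {X Y D : B} (n : X ⟶ D) (e : Y ⟶ Y) (he : e = 𝟙 Y) (f k : X ⟶ Y)
    (hk : k = f ≫ e) (hk' : k = f) :
    (pushoutCompIso n f e k hk).hom ≫ (pushoutIdIso (pushout.inr n f) e he).hom =
    eqToHom (by rw [hk']) := by
  subst hk'
  apply pushout.hom_ext <;> simp [pushoutCompIso, pushoutIdIso, pushout.inl_desc, pushout.inr_desc,
    pushout.inl_desc_assoc, pushout.inr_desc_assoc, Category.assoc, Category.comp_id,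
    Category.id_comp]

/-- The canonical isomorphism `f_* ≅ 𝟭`, for `f = 𝟙 X`. -/
noncomputable def pushoutFunctorId {X : B} (f : X ⟶ X) (hf : f = 𝟙 X) :
    pushoutFunctor V f ≅ 𝟭 (EtaleGenerator V X) :=
  NatIso.ofComponents
    (fun n => (etaleMap V X).isoMk (Under.isoMk (pushoutIdIso n.obj.hom f hf)
      (inr_pushoutIdIso_hom _ f hf)))
    (fun {_ _} φ => ObjectProperty.hom_ext _ (Under.UnderMorphism.ext
      (pushoutIdIso_natural f hf φ.hom.right (Under.w φ.hom))))

/-- The canonical isomorphism `h_* ≅ g_* f_*`, for `h = f ≫ g`. -/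
noncomputable def pushoutFunctorComp {X Y Z : B} (f : X ⟶ Y) (g : Y ⟶ Z) (h : X ⟶ Z)
    (hh : h = f ≫ g) : pushoutFunctor V h ≅ pushoutFunctor V f ⋙ pushoutFunctor V g :=
  NatIso.ofComponents
    (fun n => (etaleMap V Z).isoMk (Under.isoMk (pushoutCompIso n.obj.hom f g h hh)
      (inr_pushoutCompIso_hom _ f g h hh)))
    (fun {_ _} φ => ObjectProperty.hom_ext _ (Under.UnderMorphism.ext
      (pushoutCompIso_natural f g h hh φ.hom.right (Under.w φ.hom))))

lemma eqToHom_pushoutFunctor_app {X Y : B} {f f' : X ⟶ Y} (hf : f = f')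
    (h : (pushoutFunctor V f).toCatHom = (pushoutFunctor V f').toCatHom)
    (n : EtaleGenerator V X) :
    ((eqToHom h).toNatTrans.app n).hom.right =
      eqToHom (show pushout n.obj.hom f = pushout n.obj.hom f' by rw [hf]) := by
  subst hf
  rfl

lemma pushoutCompIso_comp_inv {X Y Z D : B} (n : X ⟶ D) (f : X ⟶ Y) (g : Y ⟶ Z) (h h' : X ⟶ Z)
    (hh : h = f ≫ g) (hh' : h' = f ≫ g) (e : h = h') :
    (pushoutCompIso n f g h hh).hom ≫ (pushoutCompIso n f g h' hh').inv =
      eqToHom (by rw [e]) := by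
  subst e
  exact Iso.hom_inv_id _

/-- The pseudofunctor `j ↦ V_{D j}`, `m ↦ m_*` defined by a diagram `D` in `B`. -/
noncomputable def etalePseudofunctor {J : Type u₁} [Category.{v₁} J] (D : J ⥤ B) :
    Pseudofunctor (LocallyDiscrete J) Cat.{v, max u v} :=
  LocallyDiscrete.mkPseudofunctor
    (fun j => Cat.of (EtaleGenerator V (D.obj j)))
    (fun m => (pushoutFunctor V (D.map m)).toCatHom)
    (fun j => Cat.Hom.isoMk (pushoutFunctorId V (D.map (𝟙 j)) (D.map_id j)))
    (fun m m' => Cat.Hom.isoMk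
      (pushoutFunctorComp V (D.map m) (D.map m') (D.map (m ≫ m')) (D.map_comp m m')))
    (fun f g h => by
      apply Cat.Hom₂.ext
      apply NatTrans.ext
      funext n
      apply ObjectProperty.hom_ext
      apply Under.UnderMorphism.ext
      refine Eq.trans ?_ (eqToHom_pushoutFunctor_app V (by rw [Category.assoc]) _ n).symm
      have key := pushoutCompIso_assoc n.obj.hom (D.map f) (D.map g) (D.map h) (D.map (f ≫ g))
        (D.map (g ≫ h)) (D.map ((f ≫ g) ≫ h)) (D.map_comp _ _) (D.map_comp _ _)
        (D.map_comp _ _) (by rw [Category.assoc, D.map_comp])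
      refine Eq.trans ?_ (pushoutCompIso_comp_inv n.obj.hom _ _ _ (D.map (f ≫ g ≫ h))
        (by rw [Category.assoc, D.map_comp]) (D.map_comp _ _) (by rw [Category.assoc]))
      refine Eq.trans ?_ (comp_inv_aux _ _ _ _ key _)
      exact congrArg (_ ≫ _ ≫ ·) (Category.id_comp _))
    (fun f => by
      apply Cat.Hom₂.ext
      apply NatTrans.ext
      funext n
      apply ObjectProperty.hom_ext
      apply Under.UnderMorphism.ext
      refine Eq.trans ?_ (eqToHom_pushoutFunctor_app V (by rw [Category.id_comp]) _ n).symm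
      refine Eq.trans ?_ (pushoutCompIso_id_left (n.obj.hom) _ (D.map_id _) _ _
        (D.map_comp _ _) (by rw [Category.id_comp]))
      exact congrArg (_ ≫ ·) (Category.comp_id _))
    (fun f => by
      apply Cat.Hom₂.ext
      apply NatTrans.ext
      funext n
      apply ObjectProperty.hom_ext
      apply Under.UnderMorphism.ext
      refine Eq.trans ?_ (eqToHom_pushoutFunctor_app V (by rw [Category.comp_id]) _ n).symm
      refine Eq.trans ?_ (pushoutCompIso_id_right (n.obj.hom) _ (D.map_id _) _ _
        (D.map_comp _ _) (by rw [Category.comp_id]))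
      exact congrArg (_ ≫ ·) (Category.comp_id _))

/-- The pseudococone `a_* : V_{D j} ⥤ V_C` given by the pushout functors along the legs of a
cocone `a` on `D` with vertex `C`. -/
noncomputable def etalePseudococone {J : Type u₁} [Category.{v₁} J] {D : J ⥤ B} (a : Cocone D) :
    Pseudococone (etalePseudofunctor V D) (EtaleGenerator V a.pt) where
  leg j := pushoutFunctor V (a.ι.app j)
  iso {i j} m := (pushoutFunctorComp V (D.map m) (a.ι.app j) (a.ι.app i) (a.w m).symm).symm
  iso_id j x := by
    apply ObjectProperty.hom_ext
    apply Under.UnderMorphism.ext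
    exact ((Iso.hom_comp_eq_id _).1 (pushoutCompIso_id_left x.obj.hom (D.map (𝟙 j)) (D.map_id j)
      (a.ι.app j) (a.ι.app j) (a.w (𝟙 j)).symm rfl)).symm
  iso_comp {i j k} f g x := by
    apply ObjectProperty.hom_ext
    apply Under.UnderMorphism.ext
    exact inv_eq_aux _ _ _ _ (pushoutCompIso_assoc x.obj.hom (D.map f) (D.map g) (a.ι.app k)
      (D.map (f ≫ g)) (a.ι.app j) (a.ι.app i) (D.map_comp f g) (a.w g).symm
      (a.w (f ≫ g)).symm (a.w f).symm)

/-- The functor represented by `l : X ⟶ C` on the etale generator at `X`. -/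
def representedFunctor {X C : B} (l : X ⟶ C) : (EtaleGenerator V X)ᵒᵖ ⥤ Type v :=
  (etaleMap V X).ι.op ⋙ yoneda.obj (Under.mk l)

/-- The functor `(n, a) ↦ cod n` on the opposite of the category of elements of
`representedFunctor V l`. -/
def codomainDiagram {X C : B} (l : X ⟶ C) : (representedFunctor V l).Elementsᵒᵖ ⥤ B :=
  (CategoryOfElements.π (representedFunctor V l)).leftOp ⋙ (etaleMap V X).ι ⋙ Under.forget X

/-- The cocone `(a : cod n ⟶ C)` indexed by `(n, a)`. -/
def codomainCocone {X C : B} (l : X ⟶ C) : Cocone (codomainDiagram V l) where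
  pt := C
  ι :=
    { app := fun p => (show p.unop.1.unop.obj ⟶ Under.mk l from p.unop.2).right
      naturality := fun p q f => by
        refine Eq.trans ?_ (Category.comp_id _).symm
        exact congrArg Under.Hom.right f.unop.2 }

end

/-! Write `J` for the opposite of `∫ h_l`, with diagram `D (n, a) = cod n`. The claim reduces to one
statement: the functor from the Grothendieck construction of `j ↦ V_{D j}` to `V_C` induced by the
pushouts `a_*` is a localization at the opcartesian morphisms. This makes the comparison functor
`desc` an equivalence. It also gives the pseudocolimit property
(`isPseudocolimit_of_isLocalization`), since pseudococones embed fully faithfully in functors on the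
Grothendieck construction.

By the universal property of pushouts, a morphism of the Grothendieck construction from `x : D j ⟶
E` to `y : D k ⟶ E'` is a commutative square over some `w : j ⟶ k`. The localization criterion
`isLocalization_of_leftFractions` then asks for three approximation properties, all consequences of
finite presentability. Every object of `V_C` is a pushout of some `k : K ⟶ K'` in `V` along a map `K
⟶ C`, which factors through a stage because `K` is finitely presentable. Morphisms and equalities of
morphisms descend to a stage because an object of `V_{D j}` is finitely presentable under `D j`, and
because the pushout of `y` to `C` is a filtered colimit of its pushouts to the stages.

A presentation of `l` as a small filtered colimit supplies the stages. Its objects are finitely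
presentable under `X`, so it is final in `J`; hence `J` is filtered. The possibly large `J` is thus
replaced by small comma categories, to which finite presentability applies. -/

/-- A functor `L` inverting `W` is a localization functor at `W` if it is essentially surjective,
every morphism `L.obj X ⟶ L.obj Y` is a left fraction, and parallel morphisms which become equal
after applying `L` are coequalized by a morphism of `W`. -/
lemma CategoryTheory.Functor.isLocalization_of_leftFractions {C : Type u₁} [Category.{v₁} C]
    {D : Type u₂} [Category.{v₂} D] (L : C ⥤ D) (W : MorphismProperty C) [W.IsMultiplicative]
    (hW : W.IsInvertedBy L) [L.EssSurj]
    (hfull : ∀ {X Y : C} (g : L.obj X ⟶ L.obj Y),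
      ∃ (Y' : C) (f : X ⟶ Y') (s : Y ⟶ Y'), W s ∧ L.map f = g ≫ L.map s)
    (hfaith : ∀ {X Y : C} (f g : X ⟶ Y), L.map f = L.map g →
      ∃ (Z : C) (s : Y ⟶ Z), W s ∧ f ≫ s = g ≫ s) : L.IsLocalization W := by
  have : W.HasLeftCalculusOfFractions :=
    { exists_leftFraction := fun X Y φ => by
        have := hW φ.s φ.hs
        obtain ⟨Y', f, s, hs, h⟩ := hfull (CategoryTheory.inv (L.map φ.s) ≫ L.map φ.f)
        -- The square built from the right fraction commutes only after applying `L`; composing with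
        -- `t` makes it commute in `C`.
        obtain ⟨Z, t, ht, h'⟩ := hfaith (φ.f ≫ s) (φ.s ≫ f) (by simp [h])
        exact ⟨⟨f ≫ t, s ≫ t, W.comp_mem _ _ hs ht⟩, by simpa using h'⟩
      ext := fun X X' Y f₁ f₂ s hs h => by
        have := hW s hs
        obtain ⟨Z, t, ht, h'⟩ := hfaith f₁ f₂ (by
          rw [← cancel_epi (L.map s), ← L.map_comp, ← L.map_comp, h])
        exact ⟨Z, t, ht, h'⟩ }
  have hmap {X Y : C} (f : X ⟶ Y) :
      (Localization.Construction.lift L hW).map (W.Q.map f) = L.map f :=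
    (Functor.congr_hom (Localization.Construction.fac L hW) f).trans
      ((Category.id_comp _).trans (Category.comp_id _))
  refine ⟨hW, ?_⟩
  have hf : (Localization.Construction.lift L hW).Faithful := by
    -- With left fractions available, injectivity need only be tested on morphisms in the image of
    -- `W.Q`.
    refine Functor.faithful_of_comp_of_hasLeftCalculusOfFractions W.Q W _ ?_
    intro X Y f g h
    obtain ⟨Z, s, hs, h'⟩ := hfaith f g (by rw [← hmap f, ← hmap g]; exact h)
    have := W.Q_inverts s hs
    rw [← cancel_mono (W.Q.map s), ← W.Q.map_comp, h', W.Q.map_comp]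
  have hg : (Localization.Construction.lift L hW).Full := by
    refine ⟨fun {X Y} g => ?_⟩
    obtain ⟨X, rfl⟩ := (Localization.Construction.objEquiv W).surjective X
    obtain ⟨Y, rfl⟩ := (Localization.Construction.objEquiv W).surjective Y
    obtain ⟨Y', f, s, hs, h⟩ := hfull (X := X) (Y := Y) g
    have := W.Q_inverts s hs
    let Qf : W.Q.obj X ⟶ W.Q.obj Y := W.Q.map f ≫ CategoryTheory.inv (W.Q.map s)
    refine ⟨Qf, ?_⟩
    have := hW s hs
    have hQ : (Localization.Construction.lift L hW).map Qf ≫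
        (Localization.Construction.lift L hW).map (W.Q.map s) =
          (Localization.Construction.lift L hW).map (W.Q.map f) := by
      rw [← Functor.map_comp, Category.assoc, IsIso.inv_hom_id, Category.comp_id]
    exact (cancel_mono (L.map s)).1 ((congrArg (_ ≫ ·) (hmap s).symm).trans
      (hQ.trans ((hmap f).trans h)))
  have he : (Localization.Construction.lift L hW).EssSurj :=
    ⟨fun Y => ⟨W.Q.obj (L.objPreimage Y), ⟨L.objObjPreimageIso Y⟩⟩⟩
  exact { }

/-! ### Pseudococones as functors on the Grothendieck construction -/

namespace Pseudococone

variable {J : Type u₁} [Category.{v₁} J] {F : Pseudofunctor (LocallyDiscrete J) Cat.{v₂, u₂}}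
  {D : Type u₃} [Category.{v₃} D]

variable (F) in
/-- The functor sending a pseudococone to the induced functor on the Grothendieck construction. -/
def fromGrothendieckFunctor (E : Type w₂) [Category.{w₁} E] :
    Pseudococone F E ⥤ (Pseudofunctor.Grothendieck F ⥤ E) where
  obj c := c.fromGrothendieck
  map {c d} α :=
    { app := fun p => (α.app p.base).app p.fiber
      naturality := fun p q f => by
        have h := α.comm f.base p.fiber
        have h' := (α.app q.base).naturality f.fiber
        dsimp [fromGrothendieck] at h h' ⊢
        rw [Category.assoc, h', ← Category.assoc, ← Category.assoc]
        congr 1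
        rw [← cancel_epi ((c.iso f.base).hom.app p.fiber)]
        simp only [Iso.hom_inv_id_app_assoc]
        simp [reassoc_of% h] }
  map_id _ := rfl
  map_comp _ _ := rfl

instance (E : Type w₂) [Category.{w₁} E] : (fromGrothendieckFunctor F E).Faithful where
  map_injective {c d α β} h := by
    apply Hom.ext
    funext j
    ext x
    exact NatTrans.congr_app h (⟨j, x⟩ : Pseudofunctor.Grothendieck F)

/-- The pair of `𝟙 j` and `mapId ≫ φ` is `φ` regarded as a morphism of the Grothendieck construction
lying over an identity. By `iso_id`, the induced functor acts on it as the leg does. -/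
lemma iso_inv_app_comp_map (c : Pseudococone F D) {j : J} {x y : F.obj ⟨j⟩} (φ : x ⟶ y) :
    (c.iso (𝟙 j)).inv.app x ≫ (c.leg j).map ((F.mapId ⟨j⟩).hom.toNatTrans.app x ≫ φ) =
      (c.leg j).map φ :=
  (congrArg (_ ≫ ·) (((c.leg j).map_comp _ _).trans
    (congrArg (· ≫ _) (c.iso_id j x).symm))).trans (Iso.inv_hom_id_app_assoc _ _ _)

/-- Naturality of `τ` splits into two cases: on opcartesian morphisms it is compatibility with the
isomorphisms of the pseudococones, and on morphisms over an identity it is naturality within each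
fibre. -/
instance (E : Type w₂) [Category.{w₁} E] : (fromGrothendieckFunctor F E).Full where
  map_surjective {c d} τ := by
    let t (j : J) (x : F.obj ⟨j⟩) : (c.leg j).obj x ⟶ (d.leg j).obj x :=
      τ.app (⟨j, x⟩ : Pseudofunctor.Grothendieck F)
    have key {i j : J} (f : i ⟶ j) {x : F.obj ⟨i⟩} {y : F.obj ⟨j⟩}
        (φ : (F.map f.toLoc).toFunctor.obj x ⟶ y) :
        ((c.iso f).inv.app x ≫ (c.leg j).map φ) ≫ t j y =
          t i x ≫ (d.iso f).inv.app x ≫ (d.leg j).map φ :=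
      τ.naturality (X := ⟨i, x⟩) (Y := ⟨j, y⟩) ⟨f, φ⟩
    have comm {i j : J} (f : i ⟶ j) (x : F.obj ⟨i⟩) :
        (c.iso f).hom.app x ≫ t i x =
          t j ((F.map f.toLoc).toFunctor.obj x) ≫ (d.iso f).hom.app x := by
      have h : (c.iso f).inv.app x ≫ t j ((F.map f.toLoc).toFunctor.obj x) =
          t i x ≫ (d.iso f).inv.app x := by
        refine Eq.trans ?_ ((key f (𝟙 ((F.map f.toLoc).toFunctor.obj x))).trans ?_)
        · exact congrArg (· ≫ _) ((Category.comp_id _).symm.trans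
            (congrArg (_ ≫ ·) ((c.leg j).map_id _).symm))
        · exact congrArg (t i x ≫ ·) ((congrArg (_ ≫ ·) ((d.leg j).map_id _)).trans
            (Category.comp_id _))
      rw [← cancel_epi ((c.iso f).inv.app x), Iso.inv_hom_id_app_assoc, reassoc_of% h,
        Iso.inv_hom_id_app, Category.comp_id]
    refine ⟨{ app := fun j => { app := t j, naturality := fun x y φ => ?_ }, comm := comm }, rfl⟩
    have h := key (𝟙 j) ((F.mapId ⟨j⟩).hom.toNatTrans.app x ≫ φ)
    rwa [iso_inv_app_comp_map, iso_inv_app_comp_map] at h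

/-- If the functor on the Grothendieck construction induced by a pseudococone is a localization at
the opcartesian morphisms, then the pseudococone is a pseudocolimit. -/
lemma isPseudocolimit_of_isLocalization (c : Pseudococone F D)
    [c.fromGrothendieck.IsLocalization (opcartesianMorphisms F)] :
    IsPseudocolimit.{w₁, w₂} c := by
  intro E _
  let Ψ := fromGrothendieckFunctor F E
  let e : c.precomp E ⋙ Ψ ≅
      Localization.whiskeringLeftFunctor' c.fromGrothendieck (opcartesianMorphisms F) E :=
    NatIso.ofComponents (fun G => NatIso.ofComponents (fun p => Iso.refl _) (fun f =>
      (Category.comp_id _).trans ((G.map_comp _ _).symm.trans (Category.id_comp _).symm)))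
      (fun α => by
        ext p
        exact (Category.comp_id _).trans (Category.id_comp _).symm)
  -- Up to isomorphism the composite is precomposition with a localization functor, hence fully
  -- faithful. As `Ψ` is faithful, `c.precomp E` inherits both properties.
  have : (c.precomp E ⋙ Ψ).Full := Functor.Full.of_iso e.symm
  have : (c.precomp E ⋙ Ψ).Faithful := Functor.Faithful.of_iso e.symm
  have hf : (c.precomp E).Faithful := Functor.Faithful.of_comp _ Ψ
  have hg : (c.precomp E).Full := Functor.Full.of_comp_faithful _ Ψ
  have he : (c.precomp E).EssSurj := ⟨fun d => by
    -- The factorization of `d` through the localization is an isomorphism of functors on the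
    -- Grothendieck construction; full faithfulness of `Ψ` turns it into one of pseudococones.
    let G := Localization.lift d.fromGrothendieck d.fromGrothendieck_inverts c.fromGrothendieck
    exact ⟨G, ⟨Ψ.preimageIso (e.app G ≪≫ Localization.fac d.fromGrothendieck
      d.fromGrothendieck_inverts c.fromGrothendieck)⟩⟩⟩
  exact { }

end Pseudococone

section

variable {J : Type u₁} [Category.{v₁} J]
  (F : Pseudofunctor (LocallyDiscrete J) Cat.{v₂, u₂})

instance : (opcartesianMorphisms F).IsMultiplicative where
  id_mem p := by
    change IsIso ((F.mapId ⟨p.base⟩).hom.toNatTrans.app p.fiber)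
    infer_instance
  comp_mem {p q r} f g hf hg := by
    have : IsIso f.fiber := hf
    have : IsIso g.fiber := hg
    change IsIso ((F.mapComp f.base.toLoc g.base.toLoc).hom.toNatTrans.app p.fiber ≫
      (F.map g.base.toLoc).toFunctor.map f.fiber ≫ g.fiber)
    infer_instance

end

/-! ### Finite presentability in the category under an object -/

section

variable {B : Type u} [Category.{v} B]

/-- A pushout of a morphism between finitely presentable objects is finitely presentable in the
category under its source. -/
lemma CategoryTheory.IsPushout.isFinitelyPresentable_under {K K' X Y : B} {k : K ⟶ K'} {a : K ⟶ X}
    {b : K' ⟶ Y} {n : X ⟶ Y} (sq : IsPushout k a b n) [IsFinitelyPresentable.{v} K]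
    [IsFinitelyPresentable.{v} K'] : IsFinitelyPresentable.{v} (Under.mk n) := by
  rw [isFinitelyPresentable_iff_preservesFilteredColimitsOfSize]
  refine ⟨fun J _ _ => ⟨fun {G} => ⟨fun {c} hc => ⟨?_⟩⟩⟩⟩
  have hc' : IsColimit ((Under.forget X).mapCocone c) := isColimitOfPreserves _ hc
  have surj (f : Under.mk n ⟶ c.pt) : ∃ (j : J) (g : Under.mk n ⟶ G.obj j),
      f = g ≫ c.ι.app j := by
    have hf : n ≫ f.right = c.pt.hom := Under.w f
    obtain ⟨j, (p : K' ⟶ (G.obj j).right), (hp : p ≫ (c.ι.app j).right = b ≫ f.right)⟩ :=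
      IsFinitelyPresentable.exists_hom_of_isColimit hc' (b ≫ f.right)
    have hw (j : J) : (G.obj j).hom ≫ (c.ι.app j).right = c.pt.hom := Under.w (c.ι.app j)
    -- `K'` gives a map `p` at stage `j`, but `p` need not agree there with the structure map on
    -- `K`. They agree in the colimit, so finite presentability of `K` makes them agree at `j'`,
    -- where the pushout property applies.
    obtain ⟨j', u, u', (h : (k ≫ p) ≫ (G.map u).right = (a ≫ (G.obj j).hom) ≫ (G.map u').right)⟩ :=
      IsFinitelyPresentable.exists_eq_of_isColimit hc' (k ≫ p) (a ≫ (G.obj j).hom)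
        (show (k ≫ p) ≫ (c.ι.app j).right = (a ≫ (G.obj j).hom) ≫ (c.ι.app j).right by
          rw [Category.assoc, Category.assoc, hp, hw, ← hf, sq.w_assoc])
    rw [Category.assoc, Category.assoc, Under.w (G.map u')] at h
    refine ⟨j', Under.homMk (sq.desc (p ≫ (G.map u).right) (G.obj j').hom h)
      (sq.inr_desc _ _ _), ?_⟩
    have hu : (G.map u).right ≫ (c.ι.app j').right = (c.ι.app j).right :=
      congrArg CommaMorphism.right (c.w u)
    refine Under.UnderMorphism.ext (sq.hom_ext ?_ ?_)
    · refine hp.symm.trans ((congrArg (p ≫ ·) hu.symm).trans ?_)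
      exact (Category.assoc _ _ _).symm.trans (sq.inl_desc_assoc _ _ _ _).symm
    · exact hf.trans ((hw j').symm.trans (sq.inr_desc_assoc _ _ _ _).symm)
  have inj (i j : J) (f : Under.mk n ⟶ G.obj i) (g : Under.mk n ⟶ G.obj j)
      (h : f ≫ c.ι.app i = g ≫ c.ι.app j) :
      ∃ (k : J) (u : i ⟶ k) (v : j ⟶ k), f ≫ G.map u = g ≫ G.map v := by
    have h' : f.right ≫ (c.ι.app i).right = g.right ≫ (c.ι.app j).right :=
      congrArg CommaMorphism.right h
    -- Morphisms under `X` agree on `X` automatically, so only their restrictions to `K'` must be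
    -- equalized.
    obtain ⟨k', u, u', h⟩ := IsFinitelyPresentable.exists_eq_of_isColimit hc' (b ≫ f.right)
      (b ≫ g.right) ((Category.assoc _ _ _).trans
        ((congrArg (b ≫ ·) h').trans (Category.assoc _ _ _).symm))
    refine ⟨k', u, u', Under.UnderMorphism.ext (sq.hom_ext ?_ ?_)⟩
    · exact (Category.assoc _ _ _).symm.trans (h.trans (Category.assoc _ _ _))
    · exact (Under.w (f ≫ G.map u)).trans (Under.w (g ≫ G.map u')).symm
  exact Types.FilteredColimit.isColimitOf _ _ surj inj

lemma etaleMap_isFinitelyPresentable {V : MorphismProperty B} (hV : IsSaturatedClass V) {X : B}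
    {n : Under X} (hn : etaleMap V X n) : IsFinitelyPresentable.{v} n := by
  obtain ⟨K, K', k, a, b, hk, sq⟩ := hn
  obtain ⟨_, _⟩ := hV.isFinitelyPresentable k hk
  exact sq.isFinitelyPresentable_under

/-- Parallel morphisms out of a finitely presentable `p : X ⟶ A` under `X` which are equalized in a
filtered colimit are already equalized at some stage. -/
lemma CategoryTheory.IsFinitelyPresentable.exists_eq_of_isColimit_under
    {I : Type v} [SmallCategory I] [IsFiltered I] {G : I ⥤ B} {c : Cocone G} (hc : IsColimit c)
    {X A : B} (p : X ⟶ A) (s : (Functor.const I).obj X ⟶ G)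
    [IsFinitelyPresentable.{v} (Under.mk p)] {i : I} (f g : A ⟶ G.obj i)
    (hf : p ≫ f = s.app i) (hg : p ≫ g = s.app i) (h : f ≫ c.ι.app i = g ≫ c.ι.app i) :
    ∃ (j : I) (u : i ⟶ j), f ≫ G.map u = g ≫ G.map u := by
  have : Nonempty I := IsFiltered.nonempty
  have hs (j : I) : s.app j ≫ c.ι.app j = p ≫ f ≫ c.ι.app i := by
    obtain ⟨k, u, u', _⟩ := IsFilteredOrEmpty.cocone_objs i j
    rw [← Category.assoc, hf, ← c.w u, ← c.w u', ← Category.assoc, ← Category.assoc,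
      ← s.naturality u, ← s.naturality u']
    rfl
  obtain ⟨j, u, e⟩ := exists_eq_of_preservesColimit_coyoneda_self (X := Under.mk p)
    (Under.isColimitLiftCocone G s c _ hs hc) (Under.homMk f hf) (Under.homMk g hg)
    (Under.UnderMorphism.ext h)
  exact ⟨j, u, congrArg CommaMorphism.right e⟩

end

/-! ### The Grothendieck construction of the etale generators -/

lemma inl_pushoutMap {B : Type u} [Category.{v} B] [HasPushouts B] {X Y D D' : B} {n : X ⟶ D}
    {n' : X ⟶ D'} (f : X ⟶ Y) (r : D ⟶ D') (hr : n ≫ r = n') :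
    pushout.inl n f ≫ pushoutMap f r hr = r ≫ pushout.inl n' f :=
  pushout.inl_desc _ _ _

lemma inl_pushoutCompIso_hom {B : Type u} [Category.{v} B] [HasPushouts B] {X Y Z D : B}
    (n : X ⟶ D) (f : X ⟶ Y) (g : Y ⟶ Z) (h : X ⟶ Z) (hh : h = f ≫ g) :
    pushout.inl n h ≫ (pushoutCompIso n f g h hh).hom =
      pushout.inl n f ≫ pushout.inl (pushout.inr n f) g :=
  pushout.inl_desc _ _ _

namespace etalePseudofunctor

variable {B : Type u} [Category.{v} B] [HasPushouts B] {V : MorphismProperty B}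
  {J : Type u₁} [Category.{v₁} J] {D : J ⥤ B}

/-- An object of the Grothendieck construction of `etalePseudofunctor V D`, from an object of the
etale generator at `D.obj j`. -/
def mkObj (j : J) (y : EtaleGenerator V (D.obj j)) :
    Pseudofunctor.Grothendieck (etalePseudofunctor V D) :=
  ⟨j, y⟩

/-- The component in the etale generator of an object of the Grothendieck construction. -/
def fib (p : Pseudofunctor.Grothendieck (etalePseudofunctor V D)) :
    EtaleGenerator V (D.obj p.base) :=
  p.fiber

variable {p q r : Pseudofunctor.Grothendieck (etalePseudofunctor V D)}

/-- The morphism out of the pushout underlying a morphism of the Grothendieck construction. -/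
noncomputable def fibMap (f : p ⟶ q) :
    pushout (fib p).obj.hom (D.map f.base) ⟶ (fib q).obj.right :=
  (show (pushoutFunctor V (D.map f.base)).obj (fib p) ⟶ fib q from f.fiber).hom.right

/-- The morphism between codomains given by a morphism of the Grothendieck construction. -/
noncomputable def codMap (f : p ⟶ q) : (fib p).obj.right ⟶ (fib q).obj.right :=
  pushout.inl (fib p).obj.hom (D.map f.base) ≫ fibMap f

lemma inr_fibMap (f : p ⟶ q) :
    pushout.inr (fib p).obj.hom (D.map f.base) ≫ fibMap f = (fib q).obj.hom :=
  Under.w (show (pushoutFunctor V (D.map f.base)).obj (fib p) ⟶ fib q from f.fiber).hom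

lemma hom_codMap (f : p ⟶ q) :
    (fib p).obj.hom ≫ codMap f = D.map f.base ≫ (fib q).obj.hom := by
  rw [codMap, pushout.condition_assoc, inr_fibMap]

/-- The other restriction of `fibMap`, along `pushout.inr`, is forced by `inr_fibMap`, so a morphism
is determined by its square. -/
lemma hom_ext {f g : p ⟶ q} (h : f.base = g.base) (h' : codMap f = codMap g) : f = g := by
  obtain ⟨w, φ⟩ := f
  obtain ⟨w', φ'⟩ := g
  obtain rfl : w = w' := h
  have : φ = φ' := by
    refine ObjectProperty.hom_ext _ (Under.UnderMorphism.ext (pushout.hom_ext h' ?_))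
    exact (inr_fibMap (p := p) (q := q) ⟨w, φ⟩).trans (inr_fibMap (p := p) (q := q) ⟨w, φ'⟩).symm
  rw [this]

/-- A morphism of the Grothendieck construction, from a morphism in the base and a compatible
morphism between the codomains. -/
noncomputable def homMk (w : p.base ⟶ q.base) (ψ : (fib p).obj.right ⟶ (fib q).obj.right)
    (h : (fib p).obj.hom ≫ ψ = D.map w ≫ (fib q).obj.hom) : p ⟶ q :=
  ⟨w, ObjectProperty.homMk (Under.homMk (pushout.desc ψ (fib q).obj.hom h)
    (pushout.inr_desc _ _ _))⟩

lemma codMap_homMk (w : p.base ⟶ q.base) (ψ : (fib p).obj.right ⟶ (fib q).obj.right)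
    (h : (fib p).obj.hom ≫ ψ = D.map w ≫ (fib q).obj.hom) : codMap (homMk w ψ h) = ψ :=
  pushout.inl_desc _ _ _

lemma codMap_comp (f : p ⟶ q) (g : q ⟶ r) : codMap (f ≫ g) = codMap f ≫ codMap g := by
  have h : fibMap (f ≫ g) =
      (pushoutCompIso (fib p).obj.hom (D.map f.base) (D.map g.base) (D.map (f.base ≫ g.base))
        (D.map_comp _ _)).hom ≫
      pushoutMap (D.map g.base) (fibMap f) (inr_fibMap f) ≫ fibMap g := rfl
  have h₁ : codMap (f ≫ g) = pushout.inl (fib p).obj.hom (D.map (f.base ≫ g.base)) ≫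
    fibMap (f ≫ g) := rfl
  rw [h₁, h, codMap, codMap, reassoc_of% inl_pushoutCompIso_hom, reassoc_of% inl_pushoutMap,
    Category.assoc]

/-- The opcartesian morphism from `y` to its pushout along `D.map w`. -/
noncomputable def opcartesian {j k : J} (y : EtaleGenerator V (D.obj j)) (w : j ⟶ k) :
    mkObj j y ⟶ mkObj k ((pushoutFunctor V (D.map w)).obj y) :=
  homMk w (pushout.inl _ _) pushout.condition

lemma codMap_opcartesian {j k : J} (y : EtaleGenerator V (D.obj j)) (w : j ⟶ k) :
    codMap (opcartesian y w) = pushout.inl y.obj.hom (D.map w) :=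
  codMap_homMk _ _ _

lemma opcartesian_mem {j k : J} (y : EtaleGenerator V (D.obj j)) (w : j ⟶ k) :
    opcartesianMorphisms _ (opcartesian y w) := by
  have h : (opcartesian y w).fiber = 𝟙 ((pushoutFunctor V (D.map w)).obj y) := by
    refine ObjectProperty.hom_ext _ (Under.UnderMorphism.ext (pushout.hom_ext ?_ ?_))
    · exact (pushout.inl_desc _ _ _).trans (Category.comp_id _).symm
    · exact (pushout.inr_desc _ _ _).trans (Category.comp_id _).symm
  change IsIso (opcartesian y w).fiber
  rw [h]
  exact IsIso.id ((pushoutFunctor V (D.map w)).obj y)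

variable (a : Cocone D)

/-- The morphism of pushouts underlying a morphism in the etale generator at `a.pt`. -/
noncomputable def pushMap (φ : (etalePseudococone V a).fromGrothendieck.obj p ⟶
    (etalePseudococone V a).fromGrothendieck.obj q) :
    pushout (fib p).obj.hom (a.ι.app p.base) ⟶ pushout (fib q).obj.hom (a.ι.app q.base) :=
  (show (pushoutFunctor V (a.ι.app p.base)).obj (fib p) ⟶
    (pushoutFunctor V (a.ι.app q.base)).obj (fib q) from φ).hom.right

lemma inr_pushMap (φ : (etalePseudococone V a).fromGrothendieck.obj p ⟶
    (etalePseudococone V a).fromGrothendieck.obj q) :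
    pushout.inr (fib p).obj.hom (a.ι.app p.base) ≫ pushMap a φ =
      pushout.inr (fib q).obj.hom (a.ι.app q.base) :=
  Under.w (show (pushoutFunctor V (a.ι.app p.base)).obj (fib p) ⟶
    (pushoutFunctor V (a.ι.app q.base)).obj (fib q) from φ).hom

/-- On codomains the comparison functor is just `codMap`. With `fromGrothendieck_hom_ext`, this
reduces equations in `V_C` to equations between maps out of the codomain of `p`. -/
lemma inl_pushMap_map (f : p ⟶ q) :
    pushout.inl (fib p).obj.hom (a.ι.app p.base) ≫
      pushMap a ((etalePseudococone V a).fromGrothendieck.map f) =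
    codMap f ≫ pushout.inl (fib q).obj.hom (a.ι.app q.base) := by
  have h : pushMap a ((etalePseudococone V a).fromGrothendieck.map f) =
      (pushoutCompIso (fib p).obj.hom (D.map f.base) (a.ι.app q.base) (a.ι.app p.base)
        (a.w f.base).symm).hom ≫
      pushoutMap (a.ι.app q.base) (fibMap f) (inr_fibMap f) := rfl
  rw [h, codMap, reassoc_of% inl_pushoutCompIso_hom, inl_pushoutMap, Category.assoc]

lemma fromGrothendieck_hom_ext
    {φ φ' : (etalePseudococone V a).fromGrothendieck.obj p ⟶
      (etalePseudococone V a).fromGrothendieck.obj q}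
    (h : pushout.inl (fib p).obj.hom (a.ι.app p.base) ≫ pushMap a φ =
      pushout.inl (fib p).obj.hom (a.ι.app p.base) ≫ pushMap a φ') : φ = φ' :=
  ObjectProperty.hom_ext _ (Under.UnderMorphism.ext (pushout.hom_ext h
    ((inr_pushMap a φ).trans (inr_pushMap a φ').symm)))

end etalePseudofunctor

/-! ### Pushouts and connected colimits -/

section

variable {B : Type u} [Category.{v} B]

/-- Pushouts along `y` preserve connected colimits. -/
noncomputable def CategoryTheory.IsPushout.isColimitOfIsColimit {I : Type u₁} [Category.{v₁} I]
    [IsConnected I] {G P : I ⥤ B} {Z E : B} {y : Z ⟶ E} {s : ∀ i, Z ⟶ G.obj i}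
    {l : ∀ i, E ⟶ P.obj i} {r : ∀ i, G.obj i ⟶ P.obj i}
    (sq : ∀ i, IsPushout y (s i) (l i) (r i))
    (hl : ∀ {i j : I} (u : i ⟶ j), l i ≫ P.map u = l j)
    (hr : ∀ {i j : I} (u : i ⟶ j), r i ≫ P.map u = G.map u ≫ r j)
    {c : Cocone G} (hc : IsColimit c) {c' : Cocone P} {z : Z ⟶ c.pt} {l' : E ⟶ c'.pt}
    {r' : c.pt ⟶ c'.pt} (sq' : IsPushout y z l' r') (hz : ∀ i, s i ≫ c.ι.app i = z)
    (hl' : ∀ i, l i ≫ c'.ι.app i = l') (hr' : ∀ i, r i ≫ c'.ι.app i = c.ι.app i ≫ r') :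
    IsColimit c' := by
  have i₀ : I := Classical.arbitrary I
  let σ (t : Cocone P) : Cocone G :=
    { pt := t.pt
      ι :=
        { app := fun i => r i ≫ t.ι.app i
          naturality := fun i j u => by
            refine Eq.trans ?_ (Category.comp_id _).symm
            rw [← t.w u, reassoc_of% hr] } }
  -- Connectedness enters here: the maps `E ⟶ t.pt` obtained at the various stages all coincide,
  -- which gives a single map out of `E`.
  have hσ (t : Cocone P) (i : I) : l i ≫ t.ι.app i = l i₀ ≫ t.ι.app i₀ :=
    constant_of_preserves_morphisms (fun i => (l i ≫ t.ι.app i : E ⟶ t.pt))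
      (fun i j u => by rw [← t.w u, reassoc_of% hl]) i i₀
  have hd (t : Cocone P) : y ≫ l i₀ ≫ t.ι.app i₀ = z ≫ hc.desc (σ t) := by
    rw [← hz i₀, Category.assoc, hc.fac, (sq i₀).w_assoc]
  exact
    { desc := fun t => sq'.desc (l i₀ ≫ t.ι.app i₀) (hc.desc (σ t)) (hd t)
      fac := fun t i => by
        apply (sq i).hom_ext
        · rw [reassoc_of% hl', sq'.inl_desc]
          exact (hσ t i).symm
        · rw [reassoc_of% hr', sq'.inr_desc]
          exact hc.fac (σ t) i
      uniq := fun t m hm => by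
        apply sq'.hom_ext
        · rw [sq'.inl_desc, ← hm i₀, reassoc_of% hl']
        · rw [sq'.inr_desc]
          refine hc.hom_ext fun i => ?_
          rw [hc.fac, ← reassoc_of% hr', hm] }

lemma const_app_comp_map {I : Type u₁} [Category.{v₁} I] {G : I ⥤ B} {Z : B}
    (s : (Functor.const I).obj Z ⟶ G) {i j : I} (u : i ⟶ j) : s.app i ≫ G.map u = s.app j :=
  (s.naturality u).symm.trans (Category.id_comp _)

variable [HasPushouts B]

/-- The functoriality of the pushout of `y` along `f` in the target of `f`. -/
noncomputable def pushoutPostcomp {Z E Y Y' : B} (y : Z ⟶ E) {f : Z ⟶ Y} {f' : Z ⟶ Y'} (g : Y ⟶ Y')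
    (h : f ≫ g = f') : pushout y f ⟶ pushout y f' :=
  pushout.desc (pushout.inl y f') (g ≫ pushout.inr y f')
    (by rw [pushout.condition, ← h, Category.assoc])

lemma pushoutPostcomp_comp {Z E Y Y' Y'' : B} (y : Z ⟶ E) {f : Z ⟶ Y} {f' : Z ⟶ Y'} {f'' : Z ⟶ Y''}
    (g : Y ⟶ Y') (h : f ≫ g = f') (g' : Y' ⟶ Y'') (h' : f' ≫ g' = f'') (k : Y ⟶ Y'')
    (hk : f ≫ k = f'') (e : k = g ≫ g') :
    pushoutPostcomp y k hk = pushoutPostcomp y g h ≫ pushoutPostcomp y g' h' := by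
  subst e
  apply pushout.hom_ext <;> simp [pushoutPostcomp, pushout.inl_desc, pushout.inr_desc,
    pushout.inl_desc_assoc, pushout.inr_desc_assoc]

variable {I : Type u₁} [Category.{v₁} I] {G : I ⥤ B} {Z E : B} (y : Z ⟶ E)
  (s : (Functor.const I).obj Z ⟶ G)

/-- The pushouts of `y : Z ⟶ E` along the morphisms from `Z` to a diagram. -/
noncomputable def pushoutDiagram : I ⥤ B where
  obj i := pushout y (s.app i)
  map u := pushoutPostcomp y (G.map u) (const_app_comp_map s u)
  map_id i := by apply pushout.hom_ext <;> simp [pushoutPostcomp]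
  map_comp u u' := pushoutPostcomp_comp _ _ _ _ _ _ _ (G.map_comp u u')

variable (c : Cocone G) (z : Z ⟶ c.pt) (hz : ∀ i, s.app i ≫ c.ι.app i = z)

/-- The cocone on `pushoutDiagram y s` induced by a cocone on the diagram. -/
noncomputable def pushoutCocone : Cocone (pushoutDiagram y s) where
  pt := pushout y z
  ι :=
    { app := fun i => pushoutPostcomp y (c.ι.app i) (hz i)
      naturality := fun i j u => (pushoutPostcomp_comp y (G.map u) (const_app_comp_map s u) _ (hz j) _
        (hz i) (c.w u).symm).symm.trans
        (Category.comp_id _).symm }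

/-- The cocone `pushoutCocone` on a colimit cocone of connected shape is a colimit cocone. -/
noncomputable def isColimitPushoutCocone [IsConnected I] (hc : IsColimit c) :
    IsColimit (pushoutCocone y s c z hz) :=
  IsPushout.isColimitOfIsColimit (s := fun i => s.app i) (z := z)
    (l := fun i => pushout.inl y (s.app i)) (r := fun i => pushout.inr y (s.app i))
    (l' := pushout.inl y z) (r' := pushout.inr y z) (fun i => IsPushout.of_hasPushout y (s.app i))
    (fun _ => pushout.inl_desc _ _ _) (fun _ => pushout.inr_desc _ _ _) hc
    (IsPushout.of_hasPushout y z) hz (fun _ => pushout.inl_desc _ _ _)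
    (fun _ => pushout.inr_desc _ _ _)

end

/-! ### Approximating objects and morphisms of `V_C` at a stage -/

namespace etalePseudofunctor

section

variable {B : Type u} [Category.{v} B] {J : Type u₁} [Category.{v} J] (D : J ⥤ B) {I : Type v}
  [SmallCategory I] (d : I ⥤ J)

lemma map_comp_structuredArrow_hom {j k : J} (w : j ⟶ k) {m m' : StructuredArrow k d}
    (u : m ⟶ m') :
    D.map (w ≫ m.hom) ≫ D.map (d.map u.right) = D.map (w ≫ m'.hom) := by
  rw [← D.map_comp, Category.assoc, StructuredArrow.w]

/-- The morphisms `D.obj j ⟶ D.obj (d.obj i)` obtained from `w : j ⟶ k` and `k ⟶ d.obj i`. -/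
def structuredArrowLegs {j k : J} (w : j ⟶ k) :
    (Functor.const (StructuredArrow k d)).obj (D.obj j) ⟶ StructuredArrow.proj k d ⋙ d ⋙ D where
  app m := D.map (w ≫ m.hom)
  naturality _ _ u :=
    (Category.id_comp _).trans (map_comp_structuredArrow_hom D d w u).symm

variable {D}

lemma structuredArrowLegs_app_comp (a : Cocone D) {j k : J} (w : j ⟶ k)
    (m : StructuredArrow k d) :
    (structuredArrowLegs D d w).app m ≫
      ((a.whisker d).whisker (StructuredArrow.proj k d)).ι.app m = a.ι.app j :=
  a.w (w ≫ m.hom)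

variable [HasPushouts B]

/-- The morphisms from `D.obj i` to the pushouts of `y : D.obj j ⟶ E` along the morphisms from
`D.obj j`. -/
noncomputable def pushoutLegs {i j k : J} (w' : i ⟶ k) (w : j ⟶ k) {E : B} (y : D.obj j ⟶ E) :
    (Functor.const (StructuredArrow k d)).obj (D.obj i) ⟶
      pushoutDiagram y (structuredArrowLegs D d w) where
  app m := D.map (w' ≫ m.hom) ≫ pushout.inr y (D.map (w ≫ m.hom))
  naturality m m' u := by
    have h : pushout.inr y (D.map (w ≫ m.hom)) ≫
        (pushoutDiagram y (structuredArrowLegs D d w)).map u =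
          D.map (d.map u.right) ≫ pushout.inr y (D.map (w ≫ m'.hom)) := pushout.inr_desc _ _ _
    refine (Category.id_comp _).trans (Eq.trans ?_ (Category.assoc _ _ _).symm)
    refine ((map_comp_structuredArrow_hom D d w' u).symm =≫ _).trans ?_
    exact (Category.assoc _ _ _).trans (D.map (w' ≫ m.hom) ≫= h.symm)

variable (a : Cocone D)

/-- The cocone of pushouts of `y : D.obj j ⟶ E` along the morphisms from `D.obj j`. -/
noncomputable abbrev cobaseCocone {j k : J} (w : j ⟶ k) {E : B} (y : D.obj j ⟶ E) :
    Cocone (pushoutDiagram y (structuredArrowLegs D d w)) :=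
  pushoutCocone y (structuredArrowLegs D d w)
    ((a.whisker d).whisker (StructuredArrow.proj k d)) (a.ι.app j)
    (structuredArrowLegs_app_comp d a w)

lemma inl_cobaseCocone {j k : J} (w : j ⟶ k) {E : B} (y : D.obj j ⟶ E) (m : StructuredArrow k d) :
    pushout.inl y (D.map (w ≫ m.hom)) ≫ (cobaseCocone d a w y).ι.app m =
      pushout.inl y (a.ι.app j) :=
  pushout.inl_desc _ _ _

lemma inr_cobaseCocone {j k : J} (w : j ⟶ k) {E : B} (y : D.obj j ⟶ E) (m : StructuredArrow k d) :
    pushout.inr y (D.map (w ≫ m.hom)) ≫ (cobaseCocone d a w y).ι.app m =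
      a.ι.app (d.obj m.right) ≫ pushout.inr y (a.ι.app j) :=
  pushout.inr_desc _ _ _

/-- In the colimit the legs become the map from `D.obj i` through `a.pt` to the pushout, which is
what a morphism of `V_C` must respect. -/
lemma pushoutLegs_app_comp {i j k : J} (w' : i ⟶ k) (w : j ⟶ k) {E : B} (y : D.obj j ⟶ E)
    (m : StructuredArrow k d) :
    (pushoutLegs d w' w y).app m ≫ (cobaseCocone d a w y).ι.app m =
      a.ι.app i ≫ pushout.inr y (a.ι.app j) := by
  refine (Category.assoc _ _ _).trans ((_ ≫= inr_cobaseCocone d a w y m).trans ?_)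
  exact (Category.assoc _ _ _).symm.trans (a.w (w' ≫ m.hom) =≫ _)

variable [IsFiltered I] [d.Final]

/-- These comma categories are the index categories for finite presentability: they are small even
if `J` is not, and they record the stages of `I` lying beyond `k`. -/
lemma isFiltered_structuredArrow (k : J) : IsFiltered (StructuredArrow k d) :=
  d.final_iff_isFiltered_structuredArrow.1 inferInstance k

variable {a} in
/-- The cocone `cobaseCocone` is a colimit cocone. -/
noncomputable def isColimitCobaseCocone (hc : IsColimit (a.whisker d)) {j k : J} (w : j ⟶ k) {E : B}
    (y : D.obj j ⟶ E) : IsColimit (cobaseCocone d a w y) :=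
  have := isFiltered_structuredArrow d k
  have := IsFiltered.isConnected (StructuredArrow k d)
  isColimitPushoutCocone _ _ _ _ _ ((Functor.Final.isColimitWhiskerEquiv _ _).symm hc)

end

variable {B : Type u} [Category.{v} B] [HasPushouts B] {V : MorphismProperty B}
  (hV : IsSaturatedClass V) {J : Type u₁} [Category.{v} J] {D : J ⥤ B} {a : Cocone D}
  {I : Type v} [SmallCategory I] [IsFiltered I] (d : I ⥤ J)
  (hc : IsColimit (a.whisker d))

include hV hc

/-- The attaching map `K ⟶ C` of an object of `V_C` factors through a stage. Pushing `k` out there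
gives an object whose further pushout to `C` is the original one, by pasting. -/
lemma essSurj_fromGrothendieck : (etalePseudococone V a).fromGrothendieck.EssSurj := by
  refine ⟨fun n => ?_⟩
  obtain ⟨K, K', k, α, β, hk, sq⟩ := n.property
  obtain ⟨_, _⟩ := hV.isFinitelyPresentable k hk
  obtain ⟨i, (α' : K ⟶ D.obj (d.obj i)), (hα : α' ≫ a.ι.app (d.obj i) = α)⟩ :=
    IsFinitelyPresentable.exists_hom_of_isColimit hc α
  let y : EtaleGenerator V (D.obj (d.obj i)) :=
    ⟨Under.mk (pushout.inr k α'), K, K', k, α', pushout.inl k α', hk, IsPushout.of_hasPushout _ _⟩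
  have sq' : IsPushout k α (pushout.inl k α' ≫ pushout.inl y.obj.hom (a.ι.app (d.obj i)))
      (pushout.inr y.obj.hom (a.ι.app (d.obj i))) := by
    rw [← hα]
    exact ((IsPushout.of_hasPushout k α').flip.paste_horiz
      (IsPushout.of_hasPushout y.obj.hom (a.ι.app (d.obj i))).flip).flip
  exact ⟨mkObj (d.obj i) y, ⟨(etaleMap V a.pt).isoMk
    (Under.isoMk (sq'.isoIsPushout _ _ sq) (sq'.inr_isoIsPushout_hom _ _ sq))⟩⟩

variable [d.Final]

/-- Such a `g` amounts to a map, under `D.obj p.base`, from the codomain of `p` to the pushout of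
`q` to `C`. It factors through the pushout of `q` to some stage, and `s` is the opcartesian morphism
to that stage. -/
lemma exists_fromGrothendieck_map_eq_comp
    {p q : Pseudofunctor.Grothendieck (etalePseudofunctor V D)}
    (g : (etalePseudococone V a).fromGrothendieck.obj p ⟶
      (etalePseudococone V a).fromGrothendieck.obj q) :
    ∃ (q' : Pseudofunctor.Grothendieck (etalePseudofunctor V D)) (f : p ⟶ q') (s : q ⟶ q'),
      opcartesianMorphisms _ s ∧ (etalePseudococone V a).fromGrothendieck.map f =
        g ≫ (etalePseudococone V a).fromGrothendieck.map s := by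
  have : IsFiltered J := IsFiltered.of_final d
  let k := IsFiltered.max p.base q.base
  let wp : p.base ⟶ k := IsFiltered.leftToMax _ _
  let wq : q.base ⟶ k := IsFiltered.rightToMax _ _
  have := isFiltered_structuredArrow d k
  let y := (fib q).obj.hom
  have : IsFinitelyPresentable.{v} (Under.mk (fib p).obj.hom) :=
    etaleMap_isFinitelyPresentable hV (fib p).property
  have hg : a.ι.app p.base ≫ pushout.inr y (a.ι.app q.base) =
      (fib p).obj.hom ≫ pushout.inl (fib p).obj.hom (a.ι.app p.base) ≫ pushMap a g := by
    rw [pushout.condition_assoc, inr_pushMap]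
  obtain ⟨m, ψ, h₁, h₂⟩ := IsFinitelyPresentable.exists_hom_of_isColimit_under
    (isColimitCobaseCocone d hc wq y) (fib p).obj.hom (pushoutLegs d wp wq y)
    (pushout.inl (fib p).obj.hom (a.ι.app p.base) ≫ pushMap a g)
    (fun m => (pushoutLegs_app_comp d a wp wq y m).trans hg)
  let σ := opcartesian (fib q) (wq ≫ m.hom)
  let τ : p ⟶ mkObj (d.obj m.right) ((pushoutFunctor V (D.map (wq ≫ m.hom))).obj (fib q)) :=
    homMk (wp ≫ m.hom) ψ h₁
  refine ⟨_, τ, σ, opcartesian_mem _ _, fromGrothendieck_hom_ext a ?_⟩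
  -- The image of `σ` undoes the colimit leg: it identifies pushing `y` directly to `C` with pushing
  -- it first to the stage `m` and then to `C`.
  have key : (cobaseCocone d a wq y).ι.app m ≫
      pushMap a ((etalePseudococone V a).fromGrothendieck.map σ) =
      pushout.inl (pushout.inr y (D.map (wq ≫ m.hom))) (a.ι.app (d.obj m.right)) := by
    refine pushout.hom_ext ?_ ?_
    · refine (Category.assoc _ _ _).symm.trans ((inl_cobaseCocone d a wq y m =≫ _).trans ?_)
      exact (inl_pushMap_map a σ).trans (codMap_opcartesian _ _ =≫ _)
    · refine (Category.assoc _ _ _).symm.trans ((inr_cobaseCocone d a wq y m =≫ _).trans ?_)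
      refine (Category.assoc _ _ _).trans ((a.ι.app (d.obj m.right) ≫=
        inr_pushMap a ((etalePseudococone V a).fromGrothendieck.map σ)).trans ?_)
      exact pushout.condition.symm
  refine (inl_pushMap_map a τ).trans ?_
  refine (codMap_homMk _ _ _ =≫ _).trans ?_
  refine (ψ ≫= key.symm).trans ((Category.assoc _ _ _).symm.trans ((h₂ =≫ _).trans ?_))
  exact Category.assoc _ _ _

lemma exists_comp_eq_of_fromGrothendieck_map_eq
    {p q : Pseudofunctor.Grothendieck (etalePseudofunctor V D)} (f f' : p ⟶ q)
    (h : (etalePseudococone V a).fromGrothendieck.map f =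
      (etalePseudococone V a).fromGrothendieck.map f') :
    ∃ (q' : Pseudofunctor.Grothendieck (etalePseudofunctor V D)) (s : q ⟶ q'),
      opcartesianMorphisms _ s ∧ f ≫ s = f' ≫ s := by
  have : IsFiltered J := IsFiltered.of_final d
  -- The two squares may lie over different base morphisms; these are coequalized first, so that
  -- both become maps under `D.obj p.base` with the same structure map to the target.
  let k := IsFiltered.coeq f.base f'.base
  let wq : q.base ⟶ k := IsFiltered.coeqHom f.base f'.base
  have hw : f.base ≫ wq = f'.base ≫ wq := IsFiltered.coeq_condition _ _
  have := isFiltered_structuredArrow d k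
  let y := (fib q).obj.hom
  have : IsFinitelyPresentable.{v} (Under.mk (fib p).obj.hom) :=
    etaleMap_isFinitelyPresentable hV (fib p).property
  have hs (m : StructuredArrow k d) (f₁ : p ⟶ q) (h₁ : f₁.base ≫ wq = f.base ≫ wq) :
      (fib p).obj.hom ≫ codMap f₁ ≫ pushout.inl y (D.map (wq ≫ m.hom)) =
        D.map ((f.base ≫ wq) ≫ m.hom) ≫ pushout.inr y (D.map (wq ≫ m.hom)) := by
    rw [← Category.assoc, hom_codMap, Category.assoc, pushout.condition, ← h₁,
      ← D.map_comp_assoc, Category.assoc]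
  have m₀ : StructuredArrow k d := IsFiltered.nonempty.some
  have h' : codMap f ≫ pushout.inl y (a.ι.app q.base) =
      codMap f' ≫ pushout.inl y (a.ι.app q.base) :=
    (inl_pushMap_map a f).symm.trans ((congrArg (fun t => _ ≫ pushMap a t) h).trans
      (inl_pushMap_map a f'))
  have hl (f₁ : p ⟶ q) : (codMap f₁ ≫ pushout.inl y (D.map (wq ≫ m₀.hom))) ≫
      (cobaseCocone d a wq y).ι.app m₀ = codMap f₁ ≫ pushout.inl y (a.ι.app q.base) :=
    (Category.assoc _ _ _).trans (_ ≫= inl_cobaseCocone d a wq y m₀)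
  obtain ⟨m, u, e⟩ := IsFinitelyPresentable.exists_eq_of_isColimit_under
    (isColimitCobaseCocone d hc wq y) (fib p).obj.hom (pushoutLegs d (f.base ≫ wq) wq y) (i := m₀)
    (codMap f ≫ pushout.inl y (D.map (wq ≫ m₀.hom)))
    (codMap f' ≫ pushout.inl y (D.map (wq ≫ m₀.hom)))
    (hs m₀ f rfl) (hs m₀ f' hw.symm) ((hl f).trans (h'.trans (hl f').symm))
  have hu : pushout.inl y (D.map (wq ≫ m₀.hom)) ≫
      (pushoutDiagram y (structuredArrowLegs D d wq)).map u =
        pushout.inl y (D.map (wq ≫ m.hom)) := pushout.inl_desc _ _ _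
  have hu' (f₁ : p ⟶ q) : (codMap f₁ ≫ pushout.inl y (D.map (wq ≫ m₀.hom))) ≫
      (pushoutDiagram y (structuredArrowLegs D d wq)).map u =
        codMap (f₁ ≫ opcartesian (fib q) (wq ≫ m.hom)) :=
    (Category.assoc _ _ _).trans ((codMap f₁ ≫= hu).trans
      ((codMap f₁ ≫= (codMap_opcartesian _ _).symm).trans (codMap_comp f₁ _).symm))
  refine ⟨_, opcartesian (fib q) (wq ≫ m.hom), opcartesian_mem _ _,
    hom_ext ?_ ((hu' f).symm.trans (e.trans (hu' f')))⟩
  change f.base ≫ wq ≫ m.hom = f'.base ≫ wq ≫ m.hom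
  rw [← Category.assoc, hw, Category.assoc]

lemma isLocalization_fromGrothendieck :
    (etalePseudococone V a).fromGrothendieck.IsLocalization
      (opcartesianMorphisms (etalePseudofunctor V D)) := by
  have := essSurj_fromGrothendieck hV d hc
  exact Functor.isLocalization_of_leftFractions _ _
    (etalePseudococone V a).fromGrothendieck_inverts
    (exists_fromGrothendieck_map_eq_comp hV d hc)
    (exists_comp_eq_of_fromGrothendieck_map_eq hV d hc)

end etalePseudofunctor

/-! ### The category of elements and a presentation of `l` -/

section

variable {B : Type u} [Category.{v} B] {V : MorphismProperty B} {X C : B} {l : X ⟶ C}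

namespace representedFunctor

/-- Constructor for objects of the opposite of the category of elements. -/
def mkObj (n : EtaleGenerator V X) (a : n.obj ⟶ Under.mk l) :
    (representedFunctor V l).Elementsᵒᵖ :=
  op ⟨op n, a⟩

/-- The morphism to `l` underlying an element. -/
def element (p : (representedFunctor V l).Elementsᵒᵖ) : p.unop.1.unop.obj ⟶ Under.mk l :=
  p.unop.2

/-- The morphism of the etale generator underlying a morphism of elements. -/
def homRight {p q : (representedFunctor V l).Elementsᵒᵖ} (f : p ⟶ q) :
    p.unop.1.unop ⟶ q.unop.1.unop :=
  f.unop.1.unop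

lemma homRight_comp_element {p q : (representedFunctor V l).Elementsᵒᵖ} (f : p ⟶ q) :
    (homRight f).hom ≫ element q = element p :=
  f.unop.2

/-- Constructor for morphisms of the opposite of the category of elements. -/
def homMk {p q : (representedFunctor V l).Elementsᵒᵖ} (f : p.unop.1.unop ⟶ q.unop.1.unop)
    (h : f.hom ≫ element q = element p) : p ⟶ q :=
  Quiver.Hom.op ⟨f.op, h⟩

lemma hom_ext {p q : (representedFunctor V l).Elementsᵒᵖ} {f g : p ⟶ q}
    (h : (homRight f).hom = (homRight g).hom) : f = g :=
  Quiver.Hom.unop_inj (Subtype.ext (Quiver.Hom.unop_inj (ObjectProperty.hom_ext _ h)))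

variable {I : Type v} [SmallCategory I] (pres : ColimitPresentation I (Under.mk l))
  (hI : ∀ i, etaleMap V X (pres.diag.obj i))

/-- The functor to the opposite of the category of elements given by a presentation of `l` as a
colimit of objects of the etale generator. -/
def ofPresentation : I ⥤ (representedFunctor V l).Elementsᵒᵖ where
  obj i := mkObj ⟨pres.diag.obj i, hI i⟩ (pres.ι.app i)
  map u := homMk (ObjectProperty.homMk (pres.diag.map u))
    ((pres.ι.naturality u).trans (Category.comp_id _))
  map_id i := hom_ext (pres.diag.map_id i)
  map_comp u u' := hom_ext (pres.diag.map_comp u u')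

/-- Each `n` is finitely presentable under `X`, so its map to `l` factors through a term of the
presentation, and two such factorizations agree at a later term. For a filtered source this is
finality. -/
lemma final_ofPresentation (hV : IsSaturatedClass V) [IsFiltered I] :
    (ofPresentation pres hI).Final := by
  have hfp (p : (representedFunctor V l).Elementsᵒᵖ) :
      IsFinitelyPresentable.{v} p.unop.1.unop.obj :=
    etaleMap_isFinitelyPresentable hV p.unop.1.unop.property
  refine Functor.final_of_exists_of_isFiltered _ (fun p => ?_) (fun {p i} s s' => ?_)
  · have := hfp p
    obtain ⟨i, f, hf⟩ := IsFinitelyPresentable.exists_hom_of_isColimit pres.isColimit (element p)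
    exact ⟨i, ⟨homMk (ObjectProperty.homMk f) hf⟩⟩
  · have := hfp p
    obtain ⟨j, u, h⟩ := exists_eq_of_preservesColimit_coyoneda_self pres.isColimit
      (i := i) (homRight s).hom (homRight s').hom
      ((homRight_comp_element s).trans (homRight_comp_element s').symm)
    exact ⟨j, u, hom_ext h⟩

/-- The codomains of the objects presenting `l` have colimit `C`. -/
noncomputable def isColimitWhiskerOfPresentation [IsFiltered I] :
    IsColimit ((codomainCocone V l).whisker (ofPresentation pres hI)) :=
  have h : IsColimit ((Under.forget X).mapCocone (Cocone.mk _ pres.ι)) :=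
    isColimitOfPreserves _ pres.isColimit
  h

end representedFunctor

end

theorem mainTheorem5 {B : Type u} [Category.{v} B] [IsLocallyFinitelyPresentable.{v} B]
    (V : MorphismProperty B) (hV : IsSaturatedClass V) {X C : B} (l : X ⟶ C)
    (hl : ObjectProperty.ind.{v} (etaleMap V X) (Under.mk l)) :
    IsCofiltered (representedFunctor V l).Elements ∧
    Pseudococone.IsPseudocolimit.{w₁, w₂} (etalePseudococone V (codomainCocone V l)) ∧
    (etalePseudococone V (codomainCocone V l)).desc.EssSurj ∧
    (etalePseudococone V (codomainCocone V l)).desc.Full ∧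
    (etalePseudococone V (codomainCocone V l)).desc.Faithful := by
  obtain ⟨I, _, _, pres, hI⟩ := hl
  have := representedFunctor.final_ofPresentation pres hI hV
  have hc := representedFunctor.isColimitWhiskerOfPresentation pres hI
  have := IsFiltered.of_final (representedFunctor.ofPresentation pres hI)
  have hloc := etalePseudofunctor.isLocalization_fromGrothendieck hV
    (representedFunctor.ofPresentation pres hI) hc
  -- By construction `desc` is the factorization through the localization, so being a localization
  -- functor says exactly that it is an equivalence.
  have : (etalePseudococone V (codomainCocone V l)).desc.IsEquivalence := hloc.isEquivalence
  exact ⟨isCofiltered_of_isFiltered_op _, Pseudococone.isPseudocolimit_of_isLocalization _,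
    inferInstance, inferInstance, inferInstance⟩
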